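/- There exist absolute constants $\theta_0 \in (0,1)$, $c > 0$ and $C > 0$ such that the following holds. Let $n, p \ge 1$ be integers and let $\theta \in [0,1]$ satisfy $1/\sqrt{n} < \theta < \theta_0$ and $p \ge C n$. Let $\mathbf x_0$ be a random vector in $\mathbb R^p$ with i.i.d. entries, each equal to $\frac{1}{\sqrt{\theta p}}$ with probability $\theta$ and to $0$ with probability $1-\theta$; let $\mathbf g_1, \dots, \mathbf g_{n-1}$ be i.i.d. random vectors in $\mathbb R^p$ with law $\mathcal N(\mathbf 0, \frac1p \mathbf I)$; and let $\mathbf x_0, \mathbf g_1, \dots, \mathbf g_{n-1}$ be jointly independent. Set $\mathcal S = \mathrm{span}(\mathbf x_0, \mathbf g_1, \dots, \mathbf g_{n-1}) \subset \mathbb R^p$. Then, with probability at least $1 - c p^{-2}$, the subspace $\mathcal S$ has dimension $n$ and, simultaneously for every matrix $\mathbf Y \in \mathbb R^{p \times n}$ whose columns form an orthonormal basis of $\mathcal S$, the problem $$\min_{\mathbf q \in \mathbb R^n} \|\mathbf Y \mathbf q\|_1 \quad \text{subject to} \quad \|\mathbf q\|_2 = 1$$ has a global optimizer $\mathbf q^\star$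 which is unique up to sign (the set of global optimizers is $\{\mathbf q^\star, -\mathbf q^\star\}$), and $\mathbf Y \mathbf q^\star = \xi \mathbf x_0$ for some $\xi \ne 0$. -/

import Mathlib

open MeasureTheory ProbabilityTheory

/-- The planted sparse model in `ℝ^p`: a random vector `x₀` with i.i.d. entries that equal
`1 / √(θ p)` with probability `θ` and `0` with probability `1 - θ`, and `m` i.i.d. Gaussian vectors
`g i` with law `N(0, I / p)`, all jointly independent. -/
structure IsPlantedSparseModel {Ω : Type*} [MeasurableSpace Ω] (μ : Measure Ω) {p m : ℕ}
    (θ : unitInterval) (x₀ : Ω → EuclideanSpace ℝ (Fin p))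
    (g : Fin m → Ω → EuclideanSpace ℝ (Fin p)) : Prop where
  /-- Each entry of `x₀` has law `(1 / √(θ p)) · Ber(θ)`. -/
  hasLaw_x₀ : ∀ k : Fin p,
    HasLaw (fun ω => x₀ ω k) (bernoulliMeasure (1 / √((θ : ℝ) * (p : ℝ))) (0 : ℝ) θ) μ
  /-- Each `g i` has law `N(0, I / p)`. -/
  hasLaw_g : ∀ i : Fin m,
    HasLaw (g i)
      (multivariateGaussian (0 : EuclideanSpace ℝ (Fin p))
        ((1 / (p : ℝ)) • (1 : Matrix (Fin p) (Fin p) ℝ))) μ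
  /-- The entries of `x₀` are independent. -/
  iIndepFun_x₀ : iIndepFun (fun (k : Fin p) (ω : Ω) => x₀ ω k) μ
  /-- The vectors `g i` are independent. -/
  iIndepFun_g : iIndepFun g μ
  /-- The vector `x₀` is independent of the whole family `g`. -/
  indepFun_x₀_g : IndepFun x₀ (fun ω i => g i ω) μ

/-- The subspace `span(x₀, g₁, …, g_m)` of `ℝ^p`. -/
def plantedSubspace {p m : ℕ} (x₀ : EuclideanSpace ℝ (Fin p))
    (g : Fin m → EuclideanSpace ℝ (Fin p)) : Submodule ℝ (EuclideanSpace ℝ (Fin p)) :=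
  Submodule.span ℝ (insert x₀ (Set.range g))

/-- The `ℓ¹` norm on `ℝ^p`. -/
noncomputable def l1Norm {p : ℕ} (v : EuclideanSpace ℝ (Fin p)) : ℝ :=
  ∑ k, |v k|

/-- The vector `Y q ∈ ℝ^p`, for an orthonormal basis `Y` of a subspace `S` of `ℝ^p` (seen as the
`p × n` matrix whose columns are the basis vectors) and a coefficient vector `q ∈ ℝ^n`. -/
noncomputable def basisMul {p n : ℕ} {S : Submodule ℝ (EuclideanSpace ℝ (Fin p))}
    (Y : OrthonormalBasis (Fin n) ℝ S) (q : EuclideanSpace ℝ (Fin n)) :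
    EuclideanSpace ℝ (Fin p) :=
  ∑ i, q i • (Y i : EuclideanSpace ℝ (Fin p))

/-- The set of global optimizers of: minimize `‖Y q‖₁` subject to `‖q‖₂ = 1`. -/
def l1l2Minimizers {p n : ℕ} {S : Submodule ℝ (EuclideanSpace ℝ (Fin p))}
    (Y : OrthonormalBasis (Fin n) ℝ S) : Set (EuclideanSpace ℝ (Fin n)) :=
  {q | ‖q‖ = 1 ∧ ∀ r : EuclideanSpace ℝ (Fin n), ‖r‖ = 1 →
    l1Norm (basisMul Y q) ≤ l1Norm (basisMul Y r)}

/-- `ℓ¹/ℓ²` recovery of `x₀` from an `n`-dimensional subspace `S`: for every orthonormal basis `Y`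
of `S`, the optimizer `q⋆` exists, is unique up to sign, and satisfies `Y q⋆ = ξ x₀`, `ξ ≠ 0`. -/
def L1L2Recovers {p : ℕ} (n : ℕ) (S : Submodule ℝ (EuclideanSpace ℝ (Fin p)))
    (x₀ : EuclideanSpace ℝ (Fin p)) : Prop :=
  Module.finrank ℝ S = n ∧
    ∀ Y : OrthonormalBasis (Fin n) ℝ S,
      ∃ q : EuclideanSpace ℝ (Fin n), l1l2Minimizers Y = {q, -q} ∧
        ∃ ξ : ℝ, ξ ≠ 0 ∧ basisMul Y q = ξ • x₀

/-! Write `I` for the support of `x₀`, `h = 1 / √(θ p)` for its non-zero value, and `G z = ∑ i, z i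
• g i`. Since `x₀` is two-valued, `‖x₀‖₁ = √|I| ‖x₀‖₂`. It suffices that `√|I| ‖v‖₂ < ‖v‖₁` for all
`v = α x₀ + G z` with `z ≠ 0` (`l1L2Recovers_of_lt`).

Deterministically this follows from `‖G z‖₂ ≤ K ‖z‖`, an `ℓ¹` mass of `G z` off `I` of at least `a
√p ‖z‖`, and `|I| ≤ s² p` with `s` small. Take `α = 1`, `w = G z`. Both sides have the first-order
term `∑ k ∈ I, w k`; the left gains at most `‖w‖² / (2 h)` beyond it, the right at least the mass of
`w` off `I`. This settles small `z`. For large `z`, `‖x₀‖` is at most a multiple of `‖z‖`, and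
smallness of `s` wins.

The two bounds on `G` come from a net: for a unit `z`, `√p G z` is standard Gaussian, so a norm
above `4`, or a quarter of the entries being tiny, has probability at most `8⁻ᵖ` each, against a net
of at most `2ᵖ` points. The `ℓ¹` bound holds for all small `I` at once, so `I` may be random. The
weakest estimate is `exp (-θ p) ≤ exp (-√p)`, the probability bound for `x₀ = 0`. -/

/-! ### Nets of the unit sphere -/

/-- Volume bound for the size of a `δ`-separated subset of the unit ball. -/
theorem card_le_of_separated_unitBall {E : Type*} [NormedAddCommGroup E] [NormedSpace ℝ E]
    [FiniteDimensional ℝ E] {δ : ℝ} (hδ : 0 < δ) (s : Finset E) (hs : ∀ c ∈ s, ‖c‖ ≤ 1)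
    (h : ∀ c ∈ s, ∀ d ∈ s, c ≠ d → δ ≤ ‖c - d‖) :
    (s.card : ℝ) ≤ (1 + 2 / δ) ^ Module.finrank ℝ E := by
  borelize E
  let μ : Measure E := Measure.addHaar
  have hρ : 0 < 1 + δ / 2 := by positivity
  have hδ2 : 0 < δ / 2 := by positivity
  have D : Set.Pairwise (s : Set E) (Function.onFun Disjoint fun c => Metric.ball c (δ / 2)) := by
    rintro c hc d hd hcd
    apply Metric.ball_disjoint_ball
    rw [dist_eq_norm]
    linarith [h c hc d hd hcd]
  have A_subset : (⋃ c ∈ s, Metric.ball c (δ / 2)) ⊆ Metric.ball (0 : E) (1 + δ / 2) := by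
    refine Set.iUnion₂_subset fun x hx => ?_
    apply Metric.ball_subset_ball'
    rw [dist_zero_right]
    linarith [hs x hx]
  have I : (s.card : ENNReal) * ENNReal.ofReal ((δ / 2) ^ Module.finrank ℝ E)
      * μ (Metric.ball 0 1) ≤
      ENNReal.ofReal ((1 + δ / 2) ^ Module.finrank ℝ E) * μ (Metric.ball 0 1) :=
    calc
      _ = μ (⋃ c ∈ s, Metric.ball c (δ / 2)) := by
        rw [measure_biUnion_finset D fun c _ => measurableSet_ball]
        simp only [μ.addHaar_ball_of_pos _ hδ2, Finset.sum_const, nsmul_eq_mul, mul_assoc]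
      _ ≤ μ (Metric.ball (0 : E) (1 + δ / 2)) := measure_mono A_subset
      _ = _ := by simp only [μ.addHaar_ball_of_pos _ hρ]
  have J := (ENNReal.mul_le_mul_iff_left (Metric.measure_ball_pos μ (0 : E) zero_lt_one).ne'
    measure_ball_lt_top.ne).1 I
  have K := ENNReal.toReal_le_of_le_ofReal (pow_nonneg hρ.le _) J
  rw [ENNReal.toReal_mul, ENNReal.toReal_natCast, ENNReal.toReal_ofReal (by positivity)] at K
  have : (1 + 2 / δ) = (1 + δ / 2) / (δ / 2) := by field_simp; ring
  rw [this, div_pow, le_div_iff₀ (by positivity)]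
  exact K

/-- The unit sphere has a `δ`-net of size at most `(1 + 2 / δ) ^ dim`. -/
theorem exists_sphere_net (E : Type*) [NormedAddCommGroup E] [NormedSpace ℝ E]
    [FiniteDimensional ℝ E] {δ : ℝ} (hδ : 0 < δ) :
    ∃ N : Finset E, (∀ z ∈ N, ‖z‖ = 1) ∧ (∀ z : E, ‖z‖ = 1 → ∃ z' ∈ N, ‖z - z'‖ < δ) ∧
      (N.card : ℝ) ≤ (1 + 2 / δ) ^ Module.finrank ℝ E := by
  classical
  -- A separated set of maximal cardinality is a net: an uncovered point could be added to it. The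
  -- volume bound makes the maximum exist.
  let P : ℕ → Prop := fun k => ∃ s : Finset E, s.card = k ∧ (∀ c ∈ s, ‖c‖ = 1) ∧
    ∀ c ∈ s, ∀ d ∈ s, c ≠ d → δ ≤ ‖c - d‖
  obtain ⟨B, hB⟩ := exists_nat_ge ((1 + 2 / δ) ^ Module.finrank ℝ E)
  have hbd : ∀ k, P k → k ≤ B := by
    rintro k ⟨s, rfl, h1, h2⟩
    exact_mod_cast (card_le_of_separated_unitBall hδ s (fun c hc => (h1 c hc).le) h2).trans hB
  have h0 : P 0 := ⟨∅, by simp⟩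
  obtain ⟨s, hs, h1, h2⟩ : P (Nat.findGreatest P B) := Nat.findGreatest_spec (Nat.zero_le B) h0
  refine ⟨s, h1, fun z hz => ?_, card_le_of_separated_unitBall hδ s (fun c hc => (h1 c hc).le) h2⟩
  by_contra! hcon
  have hzs : z ∉ s := fun hzs => by
    have := hcon z hzs
    simp at this
    linarith
  have hP : P (s.card + 1) := by
    refine ⟨insert z s, Finset.card_insert_of_notMem hzs, ?_, ?_⟩
    · intro c hc
      rcases Finset.mem_insert.1 hc with rfl | hc
      · exact hz
      · exact h1 c hc
    · intro c hc d hd hcd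
      rcases Finset.mem_insert.1 hc with rfl | hc' <;> rcases Finset.mem_insert.1 hd with rfl | hd'
      · exact absurd rfl hcd
      · exact hcon d hd'
      · rw [norm_sub_rev]; exact hcon c hc'
      · exact h2 c hc' d hd' hcd
  have := Nat.le_findGreatest (hbd _ hP) hP
  omega

/-- A linear map bounded by `b` on a `1 / 2`-net of the unit sphere is bounded by `2 b`. -/
theorem norm_apply_le_of_net {E F : Type*} [NormedAddCommGroup E] [NormedSpace ℝ E]
    [FiniteDimensional ℝ E] [NormedAddCommGroup F] [NormedSpace ℝ F] (T : E →ₗ[ℝ] F)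
    {N : Set E} {δ b : ℝ} (hδ : δ ≤ 1 / 2) (hb : 0 ≤ b)
    (hN : ∀ z : E, ‖z‖ = 1 → ∃ z' ∈ N, ‖z - z'‖ < δ) (hT : ∀ z ∈ N, ‖T z‖ ≤ b) (z : E) :
    ‖T z‖ ≤ 2 * b * ‖z‖ := by
  let L : E →L[ℝ] F := LinearMap.toContinuousLinearMap T
  -- The operator norm is finite, so this self-bound can be solved for it.
  have hL : ‖L‖ ≤ b + ‖L‖ / 2 := by
    refine ContinuousLinearMap.opNorm_le_of_unit_norm (by positivity) fun z hz => ?_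
    obtain ⟨z', hz', hd⟩ := hN z hz
    have h1 : L z = L z' + L (z - z') := by simp
    calc ‖L z‖ ≤ ‖L z'‖ + ‖L (z - z')‖ := h1 ▸ norm_add_le _ _
      _ ≤ b + ‖L‖ * (1 / 2) := by
        gcongr
        · exact hT z' hz'
        · exact (L.le_opNorm _).trans (by gcongr; linarith)
      _ = _ := by ring
  calc ‖T z‖ = ‖L z‖ := rfl
    _ ≤ ‖L‖ * ‖z‖ := L.le_opNorm z
    _ ≤ _ := by gcongr; linarith

/-! ### `ℓ¹` mass off a small coordinate set -/

theorem sum_abs_le_sqrt_mul_norm {p : ℕ} (J : Finset (Fin p)) (v : EuclideanSpace ℝ (Fin p)) :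
    ∑ k ∈ J, |v k| ≤ √p * ‖v‖ := by
  calc ∑ k ∈ J, |v k| ≤ ∑ k, |v k| :=
        Finset.sum_le_sum_of_subset_of_nonneg (Finset.subset_univ J) fun _ _ _ => abs_nonneg _
    _ ≤ √(p * ‖v‖ ^ 2) := by
        refine Real.le_sqrt_of_sq_le ?_
        rw [EuclideanSpace.real_norm_sq_eq]
        have := sq_sum_le_card_mul_sum_sq (s := (Finset.univ : Finset (Fin p)))
          (f := fun k => |v k|)
        simpa using this
    _ = √p * ‖v‖ := by rw [Real.sqrt_mul (by positivity), Real.sqrt_sq (norm_nonneg _)]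

/-- If fewer than a quarter of the entries of `v` are smaller than `t`, then the `ℓ¹` mass of `v`
on the complement of a set containing at most a quarter of the indices is at least `t p / 2`. -/
theorem le_sum_compl_abs {p : ℕ} {t : ℝ} (ht : 0 ≤ t) (v : Fin p → ℝ) (I : Finset (Fin p))
    (hI : 4 * I.card ≤ p)
    (hv : ∀ S : Finset (Fin p), (∀ k ∈ S, |v k| < t) → 4 * S.card < p) :
    t * p / 2 ≤ ∑ k ∈ Iᶜ, |v k| := by
  classical
  set S := Finset.univ.filter fun k => |v k| < t with hS
  have hSc := hv S (by simp [hS])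
  have hcard : p ≤ 2 * (Iᶜ \ S).card := by
    have h1 := Finset.le_card_sdiff S Iᶜ
    have h2 : Iᶜ.card = p - I.card := by simp [Finset.card_compl]
    omega
  have hcard' : (p : ℝ) ≤ 2 * ((Iᶜ \ S).card : ℝ) := by exact_mod_cast hcard
  calc t * p / 2 ≤ (Iᶜ \ S).card • t := by rw [nsmul_eq_mul]; nlinarith
    _ ≤ ∑ k ∈ Iᶜ \ S, |v k| := by
        refine Finset.card_nsmul_le_sum _ _ _ fun k hk => ?_
        simpa [hS] using (Finset.mem_sdiff.1 hk).2
    _ ≤ _ := Finset.sum_le_sum_of_subset_of_nonneg Finset.sdiff_subset fun _ _ _ => abs_nonneg _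

/-- Lower `ℓ¹` bound on large coordinate sets, extended from a net of the unit sphere. -/
theorem le_sum_compl_abs_of_net {E : Type*} [NormedAddCommGroup E] [NormedSpace ℝ E]
    {p : ℕ} (T : E →ₗ[ℝ] EuclideanSpace ℝ (Fin p))
    {N : Set E} {δ η K : ℝ} (hK : 0 ≤ K) (hη : 0 ≤ η) (hδ : 4 * (K * δ) ≤ η)
    (hN : ∀ z : E, ‖z‖ = 1 → ∃ z' ∈ N, ‖z - z'‖ < δ) (hT : ∀ z, ‖T z‖ ≤ K * ‖z‖)
    (hS : ∀ z ∈ N, ∀ S : Finset (Fin p), (∀ k ∈ S, |T z k| < η / √p) → 4 * S.card < p)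
    (I : Finset (Fin p)) (hI : 4 * I.card ≤ p) (z : E) :
    η / 4 * √p * ‖z‖ ≤ ∑ k ∈ Iᶜ, |T z k| := by
  have unit : ∀ z : E, ‖z‖ = 1 → η / 4 * √p ≤ ∑ k ∈ Iᶜ, |T z k| := by
    intro z hz
    obtain ⟨z', hz', hd⟩ := hN z hz
    have h1 := le_sum_compl_abs (by positivity) (fun k => T z' k) I hI (hS z' hz')
    have h2 : η / √p * p / 2 = η / 2 * √p := by
      rw [div_mul_eq_mul_div, mul_div_assoc, Real.div_sqrt]; ring
    rw [h2] at h1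
    have h3 := sum_abs_le_sqrt_mul_norm Iᶜ (T (z' - z))
    have h4 : ‖T (z' - z)‖ ≤ K * δ := (hT _).trans (by
      rw [norm_sub_rev]; exact mul_le_mul_of_nonneg_left hd.le hK)
    have h5 : ∑ k ∈ Iᶜ, |T z' k| ≤ ∑ k ∈ Iᶜ, |T z k| + ∑ k ∈ Iᶜ, |T (z' - z) k| := by
      rw [← Finset.sum_add_distrib]
      refine Finset.sum_le_sum fun k _ => ?_
      have : T z' k = T z k + T (z' - z) k := by simp
      rw [this]
      exact abs_add_le _ _
    -- Half of the bound `η / 2 * √p` valid on the net pays for the approximation error.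
    have h6 : √p * ‖T (z' - z)‖ ≤ √p * (η / 4) := by gcongr; linarith
    linarith
  rcases eq_or_ne z 0 with rfl | hz
  · simp
  have hz' : 0 < ‖z‖ := norm_pos_iff.2 hz
  have h := unit (‖z‖⁻¹ • z) (by rw [norm_smul, norm_inv, norm_norm, inv_mul_cancel₀ hz'.ne'])
  simp only [map_smul, PiLp.smul_apply, smul_eq_mul, abs_mul, abs_inv, abs_norm,
    ← Finset.mul_sum] at h
  rw [inv_mul_eq_div, le_div_iff₀ hz'] at h
  exact h

/-! ### Deterministic recovery criterion -/

theorem l1Norm_smul {p : ℕ} (c : ℝ) (v : EuclideanSpace ℝ (Fin p)) :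
    l1Norm (c • v) = |c| * l1Norm v := by
  simp [l1Norm, abs_mul, Finset.mul_sum]

theorem norm_sq_of_two_valued {p : ℕ} {h : ℝ} {x : EuclideanSpace ℝ (Fin p)}
    {I : Finset (Fin p)} (hxI : ∀ k ∈ I, x k = h) (hxc : ∀ k ∉ I, x k = 0) :
    ‖x‖ ^ 2 = I.card * h ^ 2 := by
  rw [EuclideanSpace.real_norm_sq_eq, ← Finset.sum_subset (Finset.subset_univ I)
    (fun k _ hk => by simp [hxc k hk]), Finset.sum_congr rfl (fun k hk => by rw [hxI k hk])]
  simp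

theorem l1Norm_of_two_valued {p : ℕ} {h : ℝ} (hh : 0 ≤ h) {x : EuclideanSpace ℝ (Fin p)}
    {I : Finset (Fin p)} (hxI : ∀ k ∈ I, x k = h) (hxc : ∀ k ∉ I, x k = 0) :
    l1Norm x = I.card * h := by
  rw [l1Norm, ← Finset.sum_subset (Finset.subset_univ I)
    (fun k _ hk => by simp [hxc k hk]), Finset.sum_congr rfl (fun k hk => by rw [hxI k hk])]
  simp [abs_of_nonneg hh]

/-- The first-order terms of `ℓ¹` and `√|I| ℓ²` at a two-valued vector agree, so a perturbation
whose `ℓ¹` mass off the support beats its squared norm increases the ratio `ℓ¹ / ℓ²`. -/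
theorem sqrt_card_mul_norm_lt_l1Norm {p : ℕ} {h : ℝ} (hh : 0 < h)
    {x w : EuclideanSpace ℝ (Fin p)} {I : Finset (Fin p)} (hI : I.Nonempty)
    (hxI : ∀ k ∈ I, x k = h) (hxc : ∀ k ∉ I, x k = 0)
    (hw : ‖w‖ ^ 2 / (2 * h) < ∑ k ∈ Iᶜ, |w k|) :
    √I.card * ‖x + w‖ < l1Norm (x + w) := by
  set m : ℝ := (I.card : ℝ) with hm
  have hm0 : 0 < m := by simpa [hm] using hI.card_pos
  set s := ∑ k ∈ I, w k with hs
  have hin : inner ℝ x w = h * s := by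
    rw [PiLp.inner_apply, ← Finset.sum_subset (Finset.subset_univ I)
      (fun k _ hk => by simp [hxc k hk]), hs, Finset.mul_sum]
    exact Finset.sum_congr rfl fun k hk => by simp [hxI k hk, mul_comm]
  have hnorm : ‖x + w‖ ^ 2 = m * h ^ 2 + 2 * (h * s) + ‖w‖ ^ 2 := by
    rw [norm_add_sq_real, hin, norm_sq_of_two_valued hxI hxc]
  have hl1 : m * h + s + ∑ k ∈ Iᶜ, |w k| ≤ l1Norm (x + w) := by
    rw [l1Norm, ← Finset.sum_add_sum_compl I]
    have e1 : m * h + s ≤ ∑ k ∈ I, |(x + w) k| := by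
      have : m * h + s = ∑ k ∈ I, (h + w k) := by
        rw [Finset.sum_add_distrib, Finset.sum_const, nsmul_eq_mul]
      rw [this]
      refine Finset.sum_le_sum fun k hk => ?_
      rw [PiLp.add_apply, hxI k hk]
      exact le_abs_self _
    have e2 : ∑ k ∈ Iᶜ, |w k| = ∑ k ∈ Iᶜ, |(x + w) k| :=
      Finset.sum_congr rfl fun k hk => by
        rw [PiLp.add_apply, hxc k (Finset.mem_compl.1 hk), zero_add]
    linarith
  have hsq : (√m * ‖x + w‖) ^ 2 = m * (m * h ^ 2 + 2 * (h * s) + ‖w‖ ^ 2) := by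
    rw [mul_pow, Real.sq_sqrt hm0.le, hnorm]
  -- The square root lies below its tangent at `w = 0`, where `√m * ‖x + w‖` equals `m * h`.
  have hup : √m * ‖x + w‖ ≤ m * h + s + ‖w‖ ^ 2 / (2 * h) := by
    have h1 : 2 * (m * h) * (√m * ‖x + w‖) ≤ (√m * ‖x + w‖) ^ 2 + (m * h) ^ 2 := by
      nlinarith [sq_nonneg (√m * ‖x + w‖ - m * h)]
    have h2 : m * h + s + ‖w‖ ^ 2 / (2 * h) =
        ((√m * ‖x + w‖) ^ 2 + (m * h) ^ 2) / (2 * (m * h)) := by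
      rw [hsq]; field_simp; ring
    rw [h2, le_div_iff₀ (by positivity)]
    linarith
  linarith

/-- Deterministic recovery criterion: if `T` has operator norm at most `K` and a lower `ℓ¹` bound
off the support of the sparse two-valued vector `x`, then `x` minimizes `ℓ¹ / ℓ²` strictly. -/
theorem sqrt_card_mul_norm_lt_l1Norm_smul_add {E : Type*} [NormedAddCommGroup E] [NormedSpace ℝ E]
    {p : ℕ} (T : E →ₗ[ℝ] EuclideanSpace ℝ (Fin p)) {a K s θ : ℝ} (ha : 0 < a) (hK : 0 < K)
    (hs : 0 < s) (hsa : s * (s * K ^ 2 / (2 * a) + K) < a) (hθ : 0 < θ) (hθ1 : θ ≤ 1)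
    {x : EuclideanSpace ℝ (Fin p)} {I : Finset (Fin p)} (hI : I.Nonempty)
    (hIs : √I.card ≤ s * √p)
    (hxI : ∀ k ∈ I, x k = 1 / √(θ * p)) (hxc : ∀ k ∉ I, x k = 0)
    (hT : ∀ z, ‖T z‖ ≤ K * ‖z‖) (hl : ∀ z, a * √p * ‖z‖ ≤ ∑ k ∈ Iᶜ, |T z k|)
    (α : ℝ) {z : E} (hz : z ≠ 0) :
    √I.card * ‖α • x + T z‖ < l1Norm (α • x + T z) := by
  have hp : 0 < (p : ℝ) := by
    obtain ⟨k, _⟩ := hI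
    exact_mod_cast k.pos
  have hsp : 0 < √(p : ℝ) := Real.sqrt_pos.2 hp
  have hst : 0 < √θ := Real.sqrt_pos.2 hθ
  have hKs : s * K < a := by
    have : 0 < s * (s * K ^ 2 / (2 * a)) := by positivity
    nlinarith
  have hlow : ∀ (β : ℝ) (z : E), a * √p * ‖z‖ ≤ l1Norm (β • x + T z) := by
    intro β z
    refine (hl z).trans ?_
    rw [l1Norm, Finset.sum_congr rfl (g := fun k => |(β • x + T z) k|) (fun k hk => by
      simp [hxc k (Finset.mem_compl.1 hk)])]
    exact Finset.sum_le_sum_of_subset_of_nonneg (Finset.subset_univ _) fun _ _ _ => abs_nonneg _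
  rcases eq_or_ne α 0 with rfl | hα
  · have hz' : 0 < ‖z‖ := norm_pos_iff.2 hz
    refine lt_of_lt_of_le ?_ (hlow 0 z)
    rw [zero_smul, zero_add]
    calc √I.card * ‖T z‖ ≤ (s * √p) * (K * ‖z‖) := by gcongr; exact hT z
      _ = (s * K) * (√p * ‖z‖) := by ring
      _ < a * (√p * ‖z‖) := by gcongr
      _ = _ := by ring
  suffices H : ∀ z : E, z ≠ 0 → √I.card * ‖x + T z‖ < l1Norm (x + T z) by
    have h := H (α⁻¹ • z) (smul_ne_zero (inv_ne_zero hα) hz)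
    have e : α • x + T z = α • (x + T (α⁻¹ • z)) := by
      rw [map_smul, smul_add, smul_inv_smul₀ hα]
    rw [e, norm_smul, l1Norm_smul, Real.norm_eq_abs]
    have : 0 < |α| := abs_pos.2 hα
    nlinarith
  clear hz z
  intro z hz
  have hz' : 0 < ‖z‖ := norm_pos_iff.2 hz
  have hsq : √(θ * p) = √θ * √p := Real.sqrt_mul hθ.le _
  have hst1 : √θ ≤ 1 := Real.sqrt_le_one.2 hθ1
  -- This is the range where the quadratic term `‖T z‖ ^ 2 / (2 * h)`, with `h = 1 / √(θ * p)`,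
  -- stays below `a * √p * ‖z‖`.
  by_cases hsmall : K ^ 2 * (√θ * ‖z‖) < 2 * a
  · refine sqrt_card_mul_norm_lt_l1Norm (by positivity) hI hxI hxc (lt_of_lt_of_le ?_ (hl z))
    rw [hsq]
    have h1 : ‖T z‖ ^ 2 ≤ (K * ‖z‖) ^ 2 := by gcongr; exact hT z
    have h2 : ‖T z‖ ^ 2 / (2 * (1 / (√θ * √p))) = ‖T z‖ ^ 2 * (√θ * √p) / 2 := by
      field_simp
    rw [h2]
    calc ‖T z‖ ^ 2 * (√θ * √p) / 2 ≤ (K * ‖z‖) ^ 2 * (√θ * √p) / 2 := by gcongr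
      _ = (K ^ 2 * (√θ * ‖z‖)) * (√p * ‖z‖ / 2) := by ring
      _ < (2 * a) * (√p * ‖z‖ / 2) := by gcongr
      _ = _ := by ring
  · push Not at hsmall
    have hl1 := hlow 1 z
    rw [one_smul] at hl1
    refine lt_of_lt_of_le ?_ hl1
    -- Sparsity gives `‖x‖ ≤ s / √θ`, and `z` being large turns `1 / √θ` into a multiple of `‖z‖`.
    have hx : ‖x‖ ≤ s * K ^ 2 / (2 * a) * ‖z‖ := by
      have h1 : ‖x‖ = √I.card * (1 / (√θ * √p)) := by
        rw [← Real.sqrt_sq (norm_nonneg x), norm_sq_of_two_valued hxI hxc,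
          Real.sqrt_mul (by positivity), Real.sqrt_sq (by positivity), hsq]
      rw [h1]
      calc √I.card * (1 / (√θ * √p)) ≤ (s * √p) * (1 / (√θ * √p)) := by gcongr
        _ = s / √θ := by field_simp
        _ ≤ _ := by
          rw [div_le_iff₀ hst]
          have : 1 ≤ K ^ 2 * (√θ * ‖z‖) / (2 * a) := by rwa [le_div_iff₀ (by positivity), one_mul]
          calc s = s * 1 := (mul_one s).symm
            _ ≤ s * (K ^ 2 * (√θ * ‖z‖) / (2 * a)) := by gcongr
            _ = _ := by ring
    calc √I.card * ‖x + T z‖ ≤ (s * √p) * (s * K ^ 2 / (2 * a) * ‖z‖ + K * ‖z‖) := by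
          gcongr
          exact (norm_add_le _ _).trans (add_le_add hx (hT z))
      _ = s * (s * K ^ 2 / (2 * a) + K) * (√p * ‖z‖) := by ring
      _ < a * (√p * ‖z‖) := by gcongr
      _ = _ := by ring

/-! ### Tail bounds and Gaussian combinations -/

/-- Among i.i.d. variables, it is unlikely that a proportion `1 / M` lies in an unlikely set. -/
theorem pi_exists_large_subset_le {p : ℕ} (ν : Measure ℝ) [IsProbabilityMeasure ν] (A : Set ℝ)
    {M : ℕ} {r : ENNReal} (hr : r ≤ 1) (hA : ν A ≤ r ^ M) :
    Measure.pi (fun _ : Fin p => ν) {x | ∃ S : Finset (Fin p), p ≤ M * S.card ∧ ∀ k ∈ S, x k ∈ A}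
      ≤ (2 * r) ^ p := by
  classical
  -- Each fixed `S` costs at most `r ^ (M * S.card) ≤ r ^ p`; the factor `2 ^ p` counts the subsets.
  have hone : ∀ S : Finset (Fin p), p ≤ M * S.card →
      Measure.pi (fun _ : Fin p => ν) {x | ∀ k ∈ S, x k ∈ A} ≤ r ^ p := by
    intro S hS
    have : {x : Fin p → ℝ | ∀ k ∈ S, x k ∈ A} =
        Set.univ.pi fun k => if k ∈ S then A else Set.univ := by
      ext x
      simp only [Set.mem_ofPred_eq, Set.mem_univ_pi]
      exact forall_congr' fun k => by split_ifs with h <;> simp [h]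
    rw [this, Measure.pi_pi, ← Finset.prod_subset (Finset.subset_univ S)
      (fun k _ hk => by simp [hk]), Finset.prod_congr rfl (fun k hk => by rw [if_pos hk]),
      Finset.prod_const]
    calc ν A ^ S.card ≤ (r ^ M) ^ S.card := by gcongr
      _ = r ^ (M * S.card) := (pow_mul _ _ _).symm
      _ ≤ r ^ p := pow_le_pow_right_of_le_one' hr hS
  have hsub : {x : Fin p → ℝ | ∃ S : Finset (Fin p), p ≤ M * S.card ∧ ∀ k ∈ S, x k ∈ A} ⊆
      ⋃ S ∈ Finset.univ.filter (fun S : Finset (Fin p) => p ≤ M * S.card),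
        {x | ∀ k ∈ S, x k ∈ A} := by
    rintro x ⟨S, h1, h2⟩
    simp only [Finset.mem_filter, Finset.mem_univ, true_and, Set.mem_iUnion]
    exact ⟨S, h1, h2⟩
  calc _ ≤ ∑ S ∈ Finset.univ.filter (fun S : Finset (Fin p) => p ≤ M * S.card),
        Measure.pi (fun _ : Fin p => ν) {x | ∀ k ∈ S, x k ∈ A} :=
        (measure_mono hsub).trans (measure_biUnion_finset_le _ _)
    _ ≤ ∑ S ∈ Finset.univ.filter (fun S : Finset (Fin p) => p ≤ M * S.card), r ^ p :=
        Finset.sum_le_sum fun S hS => hone S (Finset.mem_filter.1 hS).2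
    _ ≤ ∑ S : Finset (Fin p), r ^ p :=
        Finset.sum_le_sum_of_subset (Finset.filter_subset _ _)
    _ = (2 * r) ^ p := by simp [mul_pow]

/-- The density is at most `1 / 2` because `√(2π) ≥ 2`, and the interval has length `2 t`. -/
theorem gaussianReal_abs_lt_le (t : ℝ) :
    gaussianReal 0 1 {x | |x| < t} ≤ ENNReal.ofReal t := by
  rw [gaussianReal_apply _ one_ne_zero]
  have hpdf : ∀ x, gaussianPDF 0 1 x ≤ ENNReal.ofReal (1 / 2) := by
    intro x
    rw [gaussianPDF]
    apply ENNReal.ofReal_le_ofReal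
    rw [gaussianPDFReal]
    have h2 : (2 : ℝ) ≤ √(2 * Real.pi * (1 : NNReal)) := by
      apply Real.le_sqrt_of_sq_le
      simp only [NNReal.coe_one]
      linarith [Real.pi_gt_three]
    have h3 : (√(2 * Real.pi * (1 : NNReal)))⁻¹ ≤ 1 / 2 := by
      rw [one_div]
      exact inv_anti₀ (by norm_num) h2
    have h4 : Real.exp (-(x - 0) ^ 2 / (2 * (1 : NNReal))) ≤ 1 := by
      rw [Real.exp_le_one_iff]
      apply div_nonpos_of_nonpos_of_nonneg
      · nlinarith [sq_nonneg (x - 0)]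
      · positivity
    calc _ ≤ (1 / 2 : ℝ) * 1 := by gcongr
      _ = _ := mul_one _
  have hset : {x : ℝ | |x| < t} = Set.Ioo (-t) t := by
    ext x; simp [abs_lt]
  calc _ ≤ ∫⁻ _ in {x : ℝ | |x| < t}, ENNReal.ofReal (1 / 2) := lintegral_mono fun x => hpdf x
    _ = ENNReal.ofReal (1 / 2) * ENNReal.ofReal (t - -t) := by
        rw [setLIntegral_const, hset, Real.volume_Ioo]
    _ = ENNReal.ofReal t := by
        rw [← ENNReal.ofReal_mul (by norm_num)]
        congr 1
        ring

theorem gaussianReal_pdf_smul_exp_sq_div_four (x : ℝ) :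
    gaussianPDFReal 0 1 x • Real.exp (x ^ 2 / 4) =
      (√(2 * Real.pi))⁻¹ * Real.exp (-(1 / 4) * x ^ 2) := by
  rw [gaussianPDFReal, smul_eq_mul, mul_assoc, ← Real.exp_add]
  simp only [NNReal.coe_one, mul_one, sub_zero]
  congr 2
  ring

theorem integrable_exp_sq_div_four_gaussianReal :
    Integrable (fun x : ℝ => Real.exp (x ^ 2 / 4)) (gaussianReal 0 1) := by
  rw [gaussianReal_of_var_ne_zero _ one_ne_zero, gaussianPDF_def,
    integrable_withDensity_iff_integrable_smul' (by fun_prop) (by simp)]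
  simp only [ENNReal.toReal_ofReal (gaussianPDFReal_nonneg _ _ _),
    gaussianReal_pdf_smul_exp_sq_div_four]
  exact (integrable_exp_neg_mul_sq (by norm_num)).const_mul _

theorem integral_exp_sq_div_four_gaussianReal :
    ∫ x, Real.exp (x ^ 2 / 4) ∂(gaussianReal 0 1) = √2 := by
  rw [integral_gaussianReal_eq_integral_smul one_ne_zero]
  simp_rw [gaussianReal_pdf_smul_exp_sq_div_four]
  rw [integral_const_mul, integral_gaussian, ← Real.sqrt_inv, ← Real.sqrt_mul (by positivity)]
  congr 1
  field_simp
  norm_num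

/-- Chi-squared upper tail. -/
theorem pi_gaussianReal_sum_sq_ge_le (p : ℕ) :
    Measure.pi (fun _ : Fin p => gaussianReal 0 1) {x | 16 * (p : ℝ) ≤ ∑ k, x k ^ 2}
      ≤ ENNReal.ofReal ((1 / 8) ^ p) := by
  set μ := Measure.pi (fun _ : Fin p => gaussianReal 0 1)
  have hint : Integrable (fun x : Fin p → ℝ => ∏ k, Real.exp (x k ^ 2 / 4)) μ :=
    Integrable.fintype_prod fun _ => integrable_exp_sq_div_four_gaussianReal
  have hval : ∫ x, ∏ k, Real.exp (x k ^ 2 / 4) ∂μ = √2 ^ p := by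
    have := integral_fintype_prod_eq_pow (ι := Fin p) (μ := gaussianReal 0 1)
      (fun x : ℝ => Real.exp (x ^ 2 / 4))
    rw [this, integral_exp_sq_div_four_gaussianReal, Fintype.card_fin]
  -- Chernoff bound: `√2 ^ p * exp (-4 p) ≤ (2 / 16) ^ p`.
  have hmk := mul_meas_ge_le_integral_of_nonneg
    (Filter.Eventually.of_forall fun x => Finset.prod_nonneg fun k _ => (Real.exp_pos _).le)
    hint (Real.exp (4 * p))
  have hset : {x : Fin p → ℝ | Real.exp (4 * p) ≤ ∏ k, Real.exp (x k ^ 2 / 4)} =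
      {x | 16 * (p : ℝ) ≤ ∑ k, x k ^ 2} := by
    ext x
    simp only [Set.mem_ofPred_eq]
    rw [← Real.exp_sum, Real.exp_le_exp, ← Finset.sum_div, le_div_iff₀ (by norm_num)]
    ring_nf
  rw [hset, hval] at hmk
  rw [← ofReal_measureReal]
  apply ENNReal.ofReal_le_ofReal
  have he : (16 : ℝ) ≤ Real.exp 4 := by
    have h1 : (2 : ℝ) ≤ Real.exp 1 := by linarith [Real.exp_one_gt_d9]
    have h2 : Real.exp 4 = Real.exp 1 ^ 4 := by rw [← Real.exp_nat_mul]; norm_num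
    rw [h2]
    calc (16 : ℝ) = 2 ^ 4 := by norm_num
      _ ≤ _ := by gcongr
  have h2 : √(2 : ℝ) ≤ 2 := by rw [Real.sqrt_le_left (by norm_num)]; norm_num
  have h3 : (16 : ℝ) ^ p * μ.real {x | 16 * (p : ℝ) ≤ ∑ k, x k ^ 2} ≤ 2 ^ p := by
    calc _ ≤ Real.exp (4 * p) * μ.real {x | 16 * (p : ℝ) ≤ ∑ k, x k ^ 2} := by
          gcongr
          rw [mul_comm, Real.exp_nat_mul]
          gcongr
      _ ≤ √2 ^ p := hmk
      _ ≤ _ := by gcongr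
  have h4 : ((1 : ℝ) / 8) ^ p = 2 ^ p / 16 ^ p := by rw [← div_pow]; norm_num
  rw [h4, le_div_iff₀ (by positivity), mul_comm]
  exact h3

/-- A unit combination of independent `N(0, I / p)` vectors, rescaled by `√p`, is standard. -/
theorem map_smul_sum_eq_stdGaussian {Ω : Type*} [MeasurableSpace Ω] {μ : Measure Ω}
    [IsProbabilityMeasure μ] {p m : ℕ} (hp : 0 < p) {g : Fin m → Ω → EuclideanSpace ℝ (Fin p)}
    (hlaw : ∀ i, HasLaw (g i) (multivariateGaussian (0 : EuclideanSpace ℝ (Fin p))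
        ((1 / (p : ℝ)) • (1 : Matrix (Fin p) (Fin p) ℝ))) μ)
    (hind : iIndepFun g μ) {z : EuclideanSpace ℝ (Fin m)} (hz : ‖z‖ = 1) :
    μ.map (fun ω => √p • ∑ i, z i • g i ω) =
      (Measure.pi fun _ : Fin p => gaussianReal 0 1).map (WithLp.toLp 2) := by
  have hpos : (0 : ℝ) < p := by exact_mod_cast hp
  have hS : ((1 / (p : ℝ)) • (1 : Matrix (Fin p) (Fin p) ℝ)).PosSemidef :=
    Matrix.PosSemidef.one.smul (by positivity)
  have hm : ∀ i, AEMeasurable (g i) μ := fun i => (hlaw i).aemeasurable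
  rw [map_pi_eq_stdGaussian]
  have : IsProbabilityMeasure (μ.map (fun ω => √p • ∑ i, z i • g i ω)) :=
    Measure.isProbabilityMeasure_map (by fun_prop)
  -- In the characteristic function the variances `z i ^ 2` add up to `‖z‖ ^ 2 = 1`.
  apply Measure.ext_of_charFun
  ext t
  have hind' : iIndepFun (fun i ω => z i • g i ω) μ :=
    hind.comp (fun i (v : EuclideanSpace ℝ (Fin p)) => z i • v) (fun i => by fun_prop)
  rw [charFun_map_smul_comp (by fun_prop),
    hind'.charFun_map_fun_sum_eq_prod (fun i => by fun_prop), Finset.prod_apply]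
  simp_rw [charFun_map_smul_comp (hm _), (hlaw _).map_eq, charFun_multivariateGaussian hS,
    ← Complex.exp_sum, charFun_stdGaussian]
  congr 1
  have hq : ∀ c : ℝ, (WithLp.ofLp (c • t)) ⬝ᵥ ((1 / (p : ℝ)) • (1 : Matrix (Fin p) (Fin p) ℝ)).mulVec
      (WithLp.ofLp (c • t)) = c ^ 2 * ‖t‖ ^ 2 / p := by
    intro c
    rw [Matrix.smul_mulVec, Matrix.one_mulVec, dotProduct_smul, EuclideanSpace.real_norm_sq_eq]
    simp only [dotProduct, WithLp.ofLp_smul, Pi.smul_apply, smul_eq_mul]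
    rw [mul_div_assoc, Finset.sum_div, Finset.mul_sum, Finset.mul_sum]
    exact Finset.sum_congr rfl fun k _ => by ring
  simp_rw [smul_smul, hq]
  have hsum : ∑ i, z i ^ 2 = 1 := by rw [← EuclideanSpace.real_norm_sq_eq, hz, one_pow]
  simp only [inner_zero_right, Complex.ofReal_zero, zero_mul, zero_sub]
  rw [Finset.sum_neg_distrib, neg_div]
  congr 1
  rw [← Finset.sum_div]
  congr 1
  have : ∀ i, (z i * √p) ^ 2 * ‖t‖ ^ 2 / p = z i ^ 2 * ‖t‖ ^ 2 := by
    intro i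
    rw [mul_pow, Real.sq_sqrt hpos.le]
    field_simp
  simp_rw [this, ← Complex.ofReal_sum, ← Finset.sum_mul, hsum]
  simp

/-! ### Reduction to an inequality on the span -/

/-- The linear map `z ↦ ∑ i, z i • g i`. -/
def combMap {p m : ℕ} (g : Fin m → EuclideanSpace ℝ (Fin p)) :
    EuclideanSpace ℝ (Fin m) →ₗ[ℝ] EuclideanSpace ℝ (Fin p) where
  toFun z := ∑ i, z i • g i
  map_add' z w := by simp [add_smul, Finset.sum_add_distrib]
  map_smul' c z := by simp [Finset.smul_sum, smul_smul]

theorem combMap_apply {p m : ℕ} (g : Fin m → EuclideanSpace ℝ (Fin p))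
    (z : EuclideanSpace ℝ (Fin m)) : combMap g z = ∑ i, z i • g i := rfl

theorem exists_of_mem_plantedSubspace {p m : ℕ} {x : EuclideanSpace ℝ (Fin p)}
    {g : Fin m → EuclideanSpace ℝ (Fin p)} {v : EuclideanSpace ℝ (Fin p)}
    (hv : v ∈ plantedSubspace x g) : ∃ (α : ℝ) (z : _), v = α • x + combMap g z := by
  obtain ⟨α, w, hw, rfl⟩ := Submodule.mem_span_insert.1 hv
  obtain ⟨c, rfl⟩ := (Submodule.mem_span_range_iff_exists_fun ℝ).1 hw
  exact ⟨α, WithLp.toLp 2 c, by simp [combMap_apply]⟩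

theorem finrank_plantedSubspace {p m : ℕ} {x : EuclideanSpace ℝ (Fin p)}
    {g : Fin m → EuclideanSpace ℝ (Fin p)} (hx : x ≠ 0)
    (h : ∀ (α : ℝ) (z : EuclideanSpace ℝ (Fin m)), z ≠ 0 → α • x + combMap g z ≠ 0) :
    Module.finrank ℝ (plantedSubspace x g) = m + 1 := by
  have hli : LinearIndependent ℝ (Fin.cons x g : Fin (m + 1) → EuclideanSpace ℝ (Fin p)) := by
    rw [Fintype.linearIndependent_iff]
    intro c hc
    rw [Fin.sum_univ_succ] at hc
    simp only [Fin.cons_zero, Fin.cons_succ] at hc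
    have hz : WithLp.toLp 2 (fun i : Fin m => c i.succ) = 0 := by
      by_contra hne
      exact h (c 0) _ hne (by simpa [combMap_apply] using hc)
    have hz' : ∀ i : Fin m, c i.succ = 0 := fun i => by
      simpa using congrArg (fun v : EuclideanSpace ℝ (Fin m) => v i) hz
    have h0 : c 0 = 0 := by simpa [hz', hx] using hc
    intro i
    exact Fin.cases h0 hz' i
  rw [plantedSubspace, ← Fin.range_cons, finrank_span_eq_card hli, Fintype.card_fin]

/-- An orthonormal basis is an isometry onto the span, so the problem is to minimize `ℓ¹` on the
unit sphere of the span. There the multiples of `x` attain `κ` and all other vectors exceed it.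
Strictness also excludes linear relations, which gives the dimension. -/
theorem l1L2Recovers_of_lt {p m : ℕ} {x : EuclideanSpace ℝ (Fin p)}
    {g : Fin m → EuclideanSpace ℝ (Fin p)} {κ : ℝ} (hx : x ≠ 0)
    (hκx : l1Norm x = κ * ‖x‖)
    (h : ∀ (α : ℝ) (z : EuclideanSpace ℝ (Fin m)), z ≠ 0 →
      κ * ‖α • x + combMap g z‖ < l1Norm (α • x + combMap g z)) :
    L1L2Recovers (m + 1) (plantedSubspace x g) x := by
  have hxn : 0 < ‖x‖ := norm_pos_iff.2 hx
  refine ⟨finrank_plantedSubspace hx fun α z hz h0 => ?_, fun Y => ?_⟩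
  · have := h α z hz
    rw [h0] at this
    simp [l1Norm] at this
  have hY : ∀ q, basisMul Y q = (Y.repr.symm q : EuclideanSpace ℝ (Fin p)) := by
    intro q
    rw [← Y.sum_repr_symm, basisMul, Submodule.coe_sum]
    rfl
  have hYn : ∀ q, ‖basisMul Y q‖ = ‖q‖ := by
    intro q
    rw [hY, ← Submodule.coe_norm, LinearIsometryEquiv.norm_map]
  have hxS : ‖x‖⁻¹ • x ∈ plantedSubspace x g :=
    Submodule.smul_mem _ _ (Submodule.subset_span (Set.mem_insert _ _))
  set q₀ := Y.repr ⟨‖x‖⁻¹ • x, hxS⟩ with hq₀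
  have hb0 : basisMul Y q₀ = ‖x‖⁻¹ • x := by rw [hY, hq₀, LinearIsometryEquiv.symm_apply_apply]
  have hinj : ∀ q r, basisMul Y q = basisMul Y r → q = r := by
    intro q r hqr
    rw [hY, hY] at hqr
    exact Y.repr.symm.injective (Subtype.ext hqr)
  have hbneg : ∀ q, basisMul Y (-q) = -basisMul Y q := by
    intro q; rw [hY, hY, map_neg, Submodule.coe_neg]
  have hn0 : ‖q₀‖ = 1 := by
    rw [← hYn, hb0, norm_smul, norm_inv, norm_norm, inv_mul_cancel₀ hxn.ne']
  have hl0 : l1Norm (basisMul Y q₀) = κ := by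
    rw [hb0, l1Norm_smul, hκx, abs_of_pos (inv_pos.2 hxn)]
    field_simp
  have hln : l1Norm (basisMul Y (-q₀)) = κ := by
    rw [hbneg, ← neg_one_smul ℝ, l1Norm_smul, hl0]; simp
  have key : ∀ r : EuclideanSpace ℝ (Fin (m + 1)), ‖r‖ = 1 →
      κ < l1Norm (basisMul Y r) ∨ r = q₀ ∨ r = -q₀ := by
    intro r hr
    obtain ⟨α, z, hαz⟩ := exists_of_mem_plantedSubspace (x := x) (g := g) (v := basisMul Y r)
      (by rw [hY]; exact Submodule.coe_mem _)
    by_cases hz : z = 0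
    · right
      rw [hz, map_zero, add_zero] at hαz
      have h1 : |α| * ‖x‖ = 1 := by
        rw [← Real.norm_eq_abs, ← norm_smul, ← hαz, hYn, hr]
      have h2 : |α| = ‖x‖⁻¹ := eq_inv_of_mul_eq_one_left h1
      rcases abs_choice α with h3 | h3
      · left
        apply hinj
        rw [hαz, hb0, ← h2, h3]
      · right
        apply hinj
        rw [hbneg, hαz, hb0, ← h2, h3, neg_smul, neg_neg]
    · left
      have := h α z hz
      rwa [← hαz, hYn, hr, mul_one] at this
  have hge : ∀ r : EuclideanSpace ℝ (Fin (m + 1)), ‖r‖ = 1 → κ ≤ l1Norm (basisMul Y r) := by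
    intro r hr
    rcases key r hr with h1 | rfl | rfl
    · exact h1.le
    · exact hl0.ge
    · exact hln.ge
  refine ⟨q₀, ?_, ‖x‖⁻¹, inv_ne_zero hxn.ne', hb0⟩
  ext r
  constructor
  · rintro ⟨hr, hmin⟩
    rcases key r hr with h1 | h1
    · have := hmin q₀ hn0
      linarith
    · exact h1
  · rintro (rfl | rfl)
    · exact ⟨hn0, fun r hr => hl0.trans_le (hge r hr)⟩
    · exact ⟨by rw [norm_neg, hn0], fun r hr => hln.trans_le (hge r hr)⟩

/-! ### Probabilities of the bad events -/

/-- For a fixed unit vector `z`, with overwhelming probability `∑ i, z i • g i` has norm at most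
`4`, and fewer than a quarter of its entries are very small. -/
theorem measure_combMap_bad_le {Ω : Type*} [MeasurableSpace Ω] {μ : Measure Ω}
    [IsProbabilityMeasure μ] {p m : ℕ} (hp : 0 < p) {g : Fin m → Ω → EuclideanSpace ℝ (Fin p)}
    (hlaw : ∀ i, HasLaw (g i) (multivariateGaussian (0 : EuclideanSpace ℝ (Fin p))
        ((1 / (p : ℝ)) • (1 : Matrix (Fin p) (Fin p) ℝ))) μ)
    (hind : iIndepFun g μ) {z : EuclideanSpace ℝ (Fin m)} (hz : ‖z‖ = 1) :
    μ {ω | ¬ (‖combMap (fun i => g i ω) z‖ ≤ 4 ∧ ∀ S : Finset (Fin p),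
      (∀ k ∈ S, |combMap (fun i => g i ω) z k| < (1 / 2 ^ 16) / √p) → 4 * S.card < p)}
      ≤ ENNReal.ofReal (2 * (1 / 8) ^ p) := by
  have hpos : (0 : ℝ) < p := by exact_mod_cast hp
  have hsp : 0 < √(p : ℝ) := Real.sqrt_pos.2 hpos
  have hm : ∀ i, AEMeasurable (g i) μ := fun i => (hlaw i).aemeasurable
  set W : Ω → EuclideanSpace ℝ (Fin p) := fun ω => √p • ∑ i, z i • g i ω with hW
  have hWm : AEMeasurable W μ := by fun_prop
  have hWk : ∀ ω k, W ω k = √p * combMap (fun i => g i ω) z k := fun ω k => by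
    simp only [hW, combMap_apply, PiLp.smul_apply, smul_eq_mul]
  set B₁ : Set (Fin p → ℝ) := {x | 16 * (p : ℝ) ≤ ∑ k, x k ^ 2}
  set B₂ : Set (Fin p → ℝ) := {x | ∃ S : Finset (Fin p), p ≤ 4 * S.card ∧
    ∀ k ∈ S, x k ∈ {y : ℝ | |y| < 1 / 2 ^ 16}}
  have hsub : {ω | ¬ (‖combMap (fun i => g i ω) z‖ ≤ 4 ∧ ∀ S : Finset (Fin p),
      (∀ k ∈ S, |combMap (fun i => g i ω) z k| < (1 / 2 ^ 16) / √p) → 4 * S.card < p)} ⊆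
      W ⁻¹' (MeasurableEquiv.toLp 2 (Fin p → ℝ)).symm ⁻¹' (B₁ ∪ B₂) := by
    intro ω hω
    rw [Set.mem_ofPred_eq, not_and_or] at hω
    rcases hω with hω | hω
    · left
      push Not at hω
      change 16 * (p : ℝ) ≤ ∑ k, W ω k ^ 2
      simp_rw [hWk, mul_pow, Real.sq_sqrt hpos.le]
      rw [← Finset.mul_sum, ← EuclideanSpace.real_norm_sq_eq]
      have : (4 : ℝ) ^ 2 ≤ ‖combMap (fun i => g i ω) z‖ ^ 2 := by gcongr
      nlinarith
    · right
      push Not at hω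
      obtain ⟨S, h1, h2⟩ := hω
      refine ⟨S, h2, fun k hk => ?_⟩
      change |W ω k| < 1 / 2 ^ 16
      have := h1 k hk
      rw [lt_div_iff₀ hsp] at this
      rw [hWk, abs_mul, abs_of_pos hsp, mul_comm]
      exact this
  have h2 : Measure.pi (fun _ : Fin p => gaussianReal 0 1) B₂ ≤ ENNReal.ofReal ((1 / 8) ^ p) := by
    -- The threshold is `1 / 2 ^ 16 = (1 / 16) ^ 4`, so a quarter of the entries gives `(2 / 16) ^
    -- p`.
    refine (pi_exists_large_subset_le (r := ENNReal.ofReal (1 / 16)) _ _ ?_ ?_).trans_eq ?_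
    · rw [ENNReal.ofReal_le_one]; norm_num
    · refine (gaussianReal_abs_lt_le _).trans_eq ?_
      rw [← ENNReal.ofReal_pow (by norm_num)]
      norm_num
    · rw [← ENNReal.ofReal_ofNat 2, ← ENNReal.ofReal_mul (by norm_num),
        ← ENNReal.ofReal_pow (by norm_num)]
      norm_num
  calc _ ≤ μ (W ⁻¹' ((MeasurableEquiv.toLp 2 (Fin p → ℝ)).symm ⁻¹' (B₁ ∪ B₂))) := measure_mono hsub
    _ ≤ μ.map W ((MeasurableEquiv.toLp 2 (Fin p → ℝ)).symm ⁻¹' (B₁ ∪ B₂)) :=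
        Measure.le_map_apply hWm _
    _ = Measure.pi (fun _ : Fin p => gaussianReal 0 1) (B₁ ∪ B₂) := by
        rw [map_smul_sum_eq_stdGaussian hp hlaw hind hz,
          ← MeasurableEquiv.coe_toLp, MeasurableEquiv.map_apply]
        rfl
    _ ≤ ENNReal.ofReal ((1 / 8) ^ p) + ENNReal.ofReal ((1 / 8) ^ p) :=
        (measure_union_le _ _).trans (add_le_add (pi_gaussianReal_sum_sq_ge_le p) h2)
    _ = _ := by
        rw [← ENNReal.ofReal_add (by positivity) (by positivity), two_mul]

/-- With overwhelming probability the planted vector is two-valued, non-zero and sparse. -/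
theorem measure_bernoulli_bad_le {Ω : Type*} [MeasurableSpace Ω] {μ : Measure Ω}
    [IsProbabilityMeasure μ] {p M : ℕ} {θ : unitInterval} {h : ℝ} (hh : h ≠ 0)
    (hθ : (θ : ℝ) ≤ (1 / 8) ^ M) {x : Ω → EuclideanSpace ℝ (Fin p)}
    (hlaw : ∀ k : Fin p, HasLaw (fun ω => x ω k) (bernoulliMeasure h (0 : ℝ) θ) μ)
    (hind : iIndepFun (fun (k : Fin p) (ω : Ω) => x ω k) μ) :
    μ {ω | ¬ ∃ I : Finset (Fin p), I.Nonempty ∧ M * I.card < p ∧ (∀ k ∈ I, x ω k = h) ∧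
        ∀ k ∉ I, x ω k = 0}
      ≤ ENNReal.ofReal ((1 / 4) ^ p + Real.exp (-((θ : ℝ) * p))) := by
  classical
  set ν := bernoulliMeasure h (0 : ℝ) θ
  have hmap : μ.map (fun ω k => x ω k) = Measure.pi fun _ : Fin p => ν := by
    rw [(iIndepFun_iff_map_fun_eq_pi_map fun k => (hlaw k).aemeasurable).1 hind]
    congr 1
    ext1 k
    exact (hlaw k).map_eq
  have hXm : AEMeasurable (fun ω k => x ω k) μ := aemeasurable_pi_lambda _ fun k => (hlaw k).aemeasurable
  -- `B₁` means too many non-zero entries, `B₂` that all entries vanish; values outside `{0, h}`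
  -- form a null event.
  set B₁ : Set (Fin p → ℝ) := {y | ∃ S : Finset (Fin p), p ≤ M * S.card ∧
    ∀ k ∈ S, y k ∈ ({0}ᶜ : Set ℝ)}
  set B₂ : Set (Fin p → ℝ) := Set.univ.pi fun _ => {0}
  have hνh : ν {0}ᶜ = ENNReal.ofReal θ := by
    rw [bernoulliMeasure_apply _ (by measurability), if_pos (by simpa using hh), if_neg (by simp)]
    exact (ENNReal.ofReal_eq_coe_nnreal _).symm
  have hν0 : ν {0} = ENNReal.ofReal (1 - θ) := by
    rw [bernoulliMeasure_apply _ (by measurability), if_neg (by simpa using hh), if_pos (by simp)]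
    exact (ENNReal.ofReal_eq_coe_nnreal (unitInterval.symm θ).2.1).symm
  have hνc : ν ({0, h}ᶜ) = 0 := by
    rw [bernoulliMeasure_apply _ (by measurability), if_neg (by simp), if_neg (by simp)]
  have hb1 : μ ((fun ω k => x ω k) ⁻¹' B₁) ≤ ENNReal.ofReal ((1 / 4) ^ p) := by
    refine (Measure.le_map_apply hXm _).trans ?_
    rw [hmap]
    refine (pi_exists_large_subset_le (r := ENNReal.ofReal (1 / 8)) _ _ ?_ ?_).trans_eq ?_
    · rw [ENNReal.ofReal_le_one]; norm_num
    · rw [hνh, ← ENNReal.ofReal_pow (by norm_num)]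
      exact ENNReal.ofReal_le_ofReal hθ
    · rw [← ENNReal.ofReal_ofNat 2, ← ENNReal.ofReal_mul (by norm_num),
        ← ENNReal.ofReal_pow (by norm_num)]
      norm_num
  have hb2 : μ ((fun ω k => x ω k) ⁻¹' B₂) ≤ ENNReal.ofReal (Real.exp (-((θ : ℝ) * p))) := by
    refine (Measure.le_map_apply hXm _).trans ?_
    rw [hmap, Measure.pi_pi, hν0, Finset.prod_const, Finset.card_univ, Fintype.card_fin,
      ← ENNReal.ofReal_pow (by linarith [θ.2.2])]
    apply ENNReal.ofReal_le_ofReal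
    have h1 : 1 - (θ : ℝ) ≤ Real.exp (-θ) := by linarith [Real.add_one_le_exp (-(θ : ℝ))]
    calc (1 - (θ : ℝ)) ^ p ≤ Real.exp (-θ) ^ p := by
          gcongr
          linarith [θ.2.2]
      _ = _ := by rw [← Real.exp_nat_mul]; ring_nf
  have hb3 : ∀ k, μ ((fun ω => x ω k) ⁻¹' {0, h}ᶜ) = 0 := fun k => by
    refine le_antisymm ((Measure.le_map_apply (hlaw k).aemeasurable _).trans ?_) zero_le
    rw [(hlaw k).map_eq, hνc]
  have hsub : {ω | ¬ ∃ I : Finset (Fin p), I.Nonempty ∧ M * I.card < p ∧ (∀ k ∈ I, x ω k = h) ∧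
        ∀ k ∉ I, x ω k = 0} ⊆ ((fun ω k => x ω k) ⁻¹' B₁ ∪ (fun ω k => x ω k) ⁻¹' B₂) ∪
          ⋃ k, (fun ω => x ω k) ⁻¹' {0, h}ᶜ := by
    intro ω hω
    by_contra hcon
    simp only [Set.mem_union, Set.mem_iUnion, not_or, not_exists] at hcon
    obtain ⟨⟨h1, h2⟩, h3⟩ := hcon
    refine hω ⟨Finset.univ.filter fun k => x ω k ≠ 0, ?_, ?_, ?_, ?_⟩
    · by_contra hemp
      rw [Finset.not_nonempty_iff_eq_empty, Finset.filter_eq_empty_iff] at hemp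
      exact h2 fun k _ => by simpa using hemp (Finset.mem_univ k)
    · by_contra! hcard
      exact h1 ⟨_, hcard, fun k hk => by simpa using hk⟩
    · intro k hk
      have := h3 k
      simp only [Set.mem_preimage, Set.mem_compl_iff, not_not, Set.mem_insert_iff,
        Set.mem_singleton_iff] at this
      exact this.resolve_left (by simpa using hk)
    · intro k hk
      simpa using hk
  calc _ ≤ μ ((fun ω k => x ω k) ⁻¹' B₁) + μ ((fun ω k => x ω k) ⁻¹' B₂) +
        μ (⋃ k, (fun ω => x ω k) ⁻¹' {0, h}ᶜ) :=
        (measure_mono hsub).trans ((measure_union_le _ _).trans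
          (add_le_add (measure_union_le _ _) le_rfl))
    _ ≤ _ := by
        rw [measure_iUnion_null hb3, add_zero, ENNReal.ofReal_add (by positivity) (by positivity)]
        exact add_le_add hb1 hb2

/-! ### Constants and conclusion -/

/-- The left side tends to `0` as `M` grows. `1 / √M` plays the role of `s`, and `4 ≤ M` keeps the
support within a quarter of the indices. -/
theorem exists_sparsity_constant {a K : ℝ} (ha : 0 < a) :
    ∃ M : ℕ, 4 ≤ M ∧ 1 / √M * (1 / √M * K ^ 2 / (2 * a) + K) < a := by
  have h1 : Filter.Tendsto (fun M : ℕ => 1 / √(M : ℝ)) Filter.atTop (nhds 0) := by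
    simp_rw [one_div]
    exact tendsto_inv_atTop_zero.comp
      (Real.tendsto_sqrt_atTop.comp tendsto_natCast_atTop_atTop)
  have h2 : Filter.Tendsto (fun M : ℕ => 1 / √(M : ℝ) * (1 / √(M : ℝ) * K ^ 2 / (2 * a) + K))
      Filter.atTop (nhds (0 * (0 * K ^ 2 / (2 * a) + K))) :=
    h1.mul (((h1.mul_const _).div_const _).add_const _)
  rw [zero_mul] at h2
  obtain ⟨M, hM1, hM2⟩ := ((Filter.eventually_ge_atTop 4).and (h2.eventually_lt_const ha)).exists
  exact ⟨M, hM1, hM2⟩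

/-- The `27` is `2 + 1 + 24`, where `24 = 4!` comes from `exp (√p) ≥ √p ^ 4 / 4!`. -/
theorem failure_probability_le {p : ℕ} (hp : 0 < p) {t : ℝ} (ht : √p ≤ t) :
    (2 : ℝ) ^ p * (2 * (1 / 8) ^ p) + ((1 / 4) ^ p + Real.exp (-t)) ≤ 27 * ((p : ℝ) ^ 2)⁻¹ := by
  have hpos : (0 : ℝ) < p := by exact_mod_cast hp
  have h1 : (2 : ℝ) ^ p * (2 * (1 / 8) ^ p) = 2 * (1 / 4) ^ p := by
    rw [mul_left_comm, ← mul_pow]; norm_num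
  have h2 : (1 / 4 : ℝ) ^ p ≤ ((p : ℝ) ^ 2)⁻¹ := by
    rw [one_div, inv_pow]
    apply inv_anti₀ (by positivity)
    have h3 : (p : ℝ) ≤ 2 ^ p := by exact_mod_cast Nat.lt_two_pow_self.le
    calc (p : ℝ) ^ 2 ≤ (2 ^ p) ^ 2 := by gcongr
      _ = 4 ^ p := by rw [← pow_mul, mul_comm, pow_mul]; norm_num
  have h3 : Real.exp (-t) ≤ 24 * ((p : ℝ) ^ 2)⁻¹ := by
    have h4 := Real.pow_div_factorial_le_exp (√p) (Real.sqrt_nonneg _) 4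
    have h5 : √(p : ℝ) ^ 4 = (p : ℝ) ^ 2 := by
      rw [show 4 = 2 * 2 from rfl, pow_mul, Real.sq_sqrt hpos.le]
    rw [h5] at h4
    have h6 : (p : ℝ) ^ 2 / 24 ≤ Real.exp t :=
      le_trans (by simpa [Nat.factorial] using h4) (Real.exp_le_exp.2 ht)
    rw [Real.exp_neg]
    calc (Real.exp t)⁻¹ ≤ ((p : ℝ) ^ 2 / 24)⁻¹ := inv_anti₀ (by positivity) h6
      _ = _ := by field_simp
  linarith

theorem sum_ofReal_const_add {ι : Type*} (N : Finset ι) {a b : ℝ} (ha : 0 ≤ a) (hb : 0 ≤ b) :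
    ∑ _z ∈ N, ENNReal.ofReal a + ENNReal.ofReal b = ENNReal.ofReal (N.card * a + b) := by
  rw [Finset.sum_const, nsmul_eq_mul, ENNReal.ofReal_add (by positivity) hb,
    ENNReal.ofReal_mul (Nat.cast_nonneg _), ENNReal.ofReal_natCast]

theorem theorem1 :
    ∃ θ₀ c C : ℝ, 0 < θ₀ ∧ θ₀ < 1 ∧ 0 < c ∧ 0 < C ∧
      ∀ (n p : ℕ) (θ : unitInterval), 0 < n →
        1 / √(n : ℝ) < (θ : ℝ) → (θ : ℝ) < θ₀ → C * (n : ℝ) ≤ (p : ℝ) →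
        ∀ (Ω : Type*) [MeasurableSpace Ω] (μ : Measure Ω) [IsProbabilityMeasure μ]
          (x₀ : Ω → EuclideanSpace ℝ (Fin p))
          (g : Fin (n - 1) → Ω → EuclideanSpace ℝ (Fin p)),
          IsPlantedSparseModel μ θ x₀ g →
          ∃ E : Set Ω, MeasurableSet E ∧ 1 - c * ((p : ℝ) ^ 2)⁻¹ ≤ μ.real E ∧
            ∀ ω ∈ E,
              L1L2Recovers n (plantedSubspace (x₀ ω) (fun i => g i ω)) (x₀ ω) := by
  -- `a` is `η / 4` for the entry threshold `η = 1 / 2 ^ 16`, and `K = 8` doubles the norm bound `4`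
  -- valid on the net.
  obtain ⟨M, hM4, hM⟩ := exists_sparsity_constant (a := 1 / 2 ^ 16 / 4) (K := 8)
    (by norm_num)
  -- `θ₀ = (1 / 8) ^ M` is what the sparsity union bound needs; `C = 24` keeps the net below `2 ^ p`
  -- points.
  refine ⟨(1 / 8) ^ M, 27, 24, by positivity,
    pow_lt_one₀ (by norm_num) (by norm_num) (by omega), by norm_num, by norm_num, ?_⟩
  intro n p θ hn hθn hθ hnp Ω _ μ _ x₀ g hmod
  obtain ⟨m, rfl⟩ : ∃ m, n = m + 1 := ⟨n - 1, by omega⟩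
  change Fin m → Ω → EuclideanSpace ℝ (Fin p) at g
  have hnp' : 24 * (m + 1) ≤ p := by exact_mod_cast hnp
  have hp : 0 < p := by omega
  have hpos : (0 : ℝ) < p := by exact_mod_cast hp
  have hsp : 0 < √(p : ℝ) := Real.sqrt_pos.2 hpos
  have hθ0 : (0 : ℝ) < θ := lt_of_le_of_lt (by positivity) hθn
  have hMpos : (0 : ℝ) < M := by exact_mod_cast (show 0 < M by omega)
  have hθp : √(p : ℝ) ≤ θ * p := by
    have h1 : 1 / √(p : ℝ) ≤ θ := by
      refine le_trans ?_ hθn.le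
      have : ((m + 1 : ℕ) : ℝ) ≤ p := by exact_mod_cast (show m + 1 ≤ p by omega)
      gcongr
    rw [div_le_iff₀ hsp] at h1
    calc √(p : ℝ) = 1 * √p := (one_mul _).symm
      _ ≤ (θ * √p) * √p := by gcongr
      _ = _ := by rw [mul_assoc, Real.mul_self_sqrt hpos.le]
  have hh : 0 < 1 / √((θ : ℝ) * p) := by positivity
  -- The mesh satisfies `4 * (8 * δ) = 1 / 2 ^ 17 ≤ η`.
  obtain ⟨N, hN1, hN2, hNc⟩ := exists_sphere_net (EuclideanSpace ℝ (Fin m))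
    (δ := 1 / 2 ^ 22) (by norm_num)
  have hNp : (N.card : ℝ) ≤ 2 ^ p := by
    refine hNc.trans ?_
    rw [finrank_euclideanSpace_fin]
    calc (1 + 2 / (1 / 2 ^ 22) : ℝ) ^ m ≤ (2 ^ 24) ^ m := by gcongr; norm_num
      _ = 2 ^ (24 * m) := (pow_mul _ _ _).symm
      _ ≤ 2 ^ p := pow_le_pow_right₀ (by norm_num) (by omega)
  set bad₁ : Set Ω := {ω | ¬ ∃ I : Finset (Fin p), I.Nonempty ∧ M * I.card < p ∧
    (∀ k ∈ I, x₀ ω k = 1 / √((θ : ℝ) * p)) ∧ ∀ k ∉ I, x₀ ω k = 0} with hbad₁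
  set bad₂ : EuclideanSpace ℝ (Fin m) → Set Ω := fun z =>
    {ω | ¬ (‖combMap (fun i => g i ω) z‖ ≤ 4 ∧ ∀ S : Finset (Fin p),
      (∀ k ∈ S, |combMap (fun i => g i ω) z k| < (1 / 2 ^ 16) / √p) → 4 * S.card < p)} with hbad₂
  set bad : Set Ω := (⋃ z ∈ N, bad₂ z) ∪ bad₁ with hbad
  have hμ : μ bad ≤ ENNReal.ofReal (27 * ((p : ℝ) ^ 2)⁻¹) := by
    calc μ bad ≤ ∑ z ∈ N, μ (bad₂ z) + μ bad₁ :=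
          (measure_union_le _ _).trans (add_le_add (measure_biUnion_finset_le _ _) le_rfl)
      _ ≤ ∑ z ∈ N, ENNReal.ofReal (2 * (1 / 8) ^ p) +
          ENNReal.ofReal ((1 / 4) ^ p + Real.exp (-((θ : ℝ) * p))) := by
          refine add_le_add (Finset.sum_le_sum fun z hz => ?_) ?_
          · exact measure_combMap_bad_le hp hmod.hasLaw_g hmod.iIndepFun_g (hN1 z hz)
          · exact measure_bernoulli_bad_le hh.ne' hθ.le hmod.hasLaw_x₀ hmod.iIndepFun_x₀
      _ = ENNReal.ofReal (N.card * (2 * (1 / 8) ^ p) +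
          ((1 / 4) ^ p + Real.exp (-((θ : ℝ) * p)))) := by
          exact sum_ofReal_const_add N (by positivity) (by positivity)
      _ ≤ _ := by
          apply ENNReal.ofReal_le_ofReal
          refine le_trans ?_ (failure_probability_le hp hθp)
          gcongr
  -- The bad set need not be measurable; its measurable hull has the same measure.
  refine ⟨(toMeasurable μ bad)ᶜ, (measurableSet_toMeasurable _ _).compl, ?_, fun ω hω => ?_⟩
  · rw [probReal_compl_eq_one_sub (measurableSet_toMeasurable _ _), measureReal_def,
      measure_toMeasurable]
    have := ENNReal.toReal_le_of_le_ofReal (by positivity) hμ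
    linarith
  · have hgood : ω ∉ bad := fun h => hω (subset_toMeasurable _ _ h)
    simp only [hbad, hbad₁, hbad₂, Set.mem_union, Set.mem_iUnion, not_or, not_exists,
      Set.mem_ofPred_eq, not_not] at hgood
    obtain ⟨hg2, hg1⟩ := hgood
    obtain ⟨I, hI, hIM, hxI, hxc⟩ := not_forall_not.1 hg1
    have hT : ∀ z, ‖combMap (fun i => g i ω) z‖ ≤ 8 * ‖z‖ := by
      intro z
      have := norm_apply_le_of_net (combMap fun i => g i ω) (N := (N : Set _)) (b := 4)
        (δ := 1 / 2 ^ 22) (by norm_num) (by norm_num) hN2 (fun z hz => (hg2 z hz).1) z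
      linarith
    have h4I : 4 * I.card ≤ p := (Nat.mul_le_mul_right _ hM4).trans hIM.le
    have hl := le_sum_compl_abs_of_net (combMap fun i => g i ω) (N := (N : Set _)) (K := 8)
      (δ := 1 / 2 ^ 22) (η := 1 / 2 ^ 16) (by norm_num) (by norm_num) (by norm_num) hN2 hT
      (fun z hz => (hg2 z hz).2) I h4I
    have hIs : √(I.card : ℝ) ≤ 1 / √M * √p := by
      rw [one_div_mul_eq_div, ← Real.sqrt_div hpos.le]
      apply Real.sqrt_le_sqrt
      rw [le_div_iff₀ hMpos, mul_comm]
      exact_mod_cast hIM.le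
    have hIc : (0 : ℝ) < I.card := by exact_mod_cast hI.card_pos
    have hnorm := norm_sq_of_two_valued hxI hxc
    have hx : x₀ ω ≠ 0 := by
      rintro h0
      rw [h0, norm_zero] at hnorm
      have : (0 : ℝ) < I.card * (1 / √((θ : ℝ) * p)) ^ 2 := mul_pos hIc (pow_pos hh 2)
      linarith
    refine l1L2Recovers_of_lt (κ := √I.card) hx ?_ fun α z hz => ?_
    · rw [l1Norm_of_two_valued hh.le hxI hxc, ← Real.sqrt_sq (norm_nonneg (x₀ ω)), hnorm,
        Real.sqrt_mul hIc.le, Real.sqrt_sq hh.le, ← mul_assoc, Real.mul_self_sqrt hIc.le]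
    · exact sqrt_card_mul_norm_lt_l1Norm_smul_add _ (by norm_num) (by norm_num)
        (one_div_pos.2 (Real.sqrt_pos.2 hMpos)) hM hθ0 θ.2.2 hI hIs hxI hxc hT hl α hz
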